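/- Let $G$ be a finite group acting by automorphisms on a field $L$, with fixed field $K$. Let $N$ be the kernel of the action and put $g=|G|$, $n=|N|$, $h=[L:K]$, so that $g=nh$; assume that $n$ is invertible in $K$. Let $S\subseteq K$ be a discrete valuation ring with field of fractions $K$, with maximal ideal generated by $\pi$ and with $\pi$-adic valuation $v$ on $K$, and let $T$ be the integral closure of $S$ in $L$. For a commutative ring $C$ with an action of $G$ by automorphisms, $C\wr G$ denotes the twisted group ring: the free $C$-module on the set $G$ with multiplication $(y\sigma)(z\tau)=y\,\sigma(z)\,\sigma\tau$ for $\sigma,\tau\in G$, $y,z\in C$. Modules are left modules. Thus $T\wr G\subseteq L\wr G$. Put $\bar T=T/\pi T$, with the induced action of $G$. Let $T^+=\{y\in L : \mathrm{Tr}_{L/K}(yT)\subseteq S\}$ and let $t\ge 0$ be the integer with $\{z\in S : zT^+\subseteq T\}=\pi^tS$. (Equivalently, $t$ is the maximal elementary divisor exponent of the Gram matrix, with respect to an $S$-basis of $T$, of the trace form $(y,z)\mapsto\mathrm{Tr}_{L/K}(yz)$.) Let $X$ be a simple $L\wr G$-module and let $x$ be its dimension over the skew field $\mathrm{End}_{L\wr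 G}(X)$. Suppose that $\mathrm{End}_{L\wr G}(X)=K$ and that $$v(x)=v(g)+t,\qquad\text{in the sense that}\qquad v(x/g)=t .$$ Here the rational number $x/g=(x/h)/n$ is regarded as an element of $K$, which is possible since $h$ divides $x$ and $n$ is invertible in $K$. If the characteristic of $K$ does not divide $g$, this is literally $v(x)=v(g)+t$. Let $V\subseteq X$ be a finitely generated $T\wr G$-submodule with $KV=X$. Then $V/\pi V$ is a simple $\bar T\wr G$-module. -/

import Mathlib

open scoped WithZero

noncomputable section

/-- The twisted (skew) group ring `C ≀ G` of a group `G` acting on a commutative ring `C` by ring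
automorphisms: the free `C`-module on `G`, with `(y σ) * (z τ) = (y * σ(z)) (σ τ)`; here `y σ` is
`SkewMonoidAlgebra.single σ y`. Modules over it are left modules. -/
abbrev TwistedGroupRing (C G : Type*) [CommRing C] [Group G] [MulSemiringAction G C] : Type _ :=
  SkewMonoidAlgebra C G

namespace TwistedGroupRing

open SkewMonoidAlgebra

section Map

variable {C D G : Type*} [CommRing C] [CommRing D] [Group G]
  [MulSemiringAction G C] [MulSemiringAction G D]

/-- The coefficients, as a subring `C → C ≀ G`, `c ↦ c 1`. -/
def coeffHom : C →+* TwistedGroupRing C G where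
  toFun c := single 1 c
  map_one' := rfl
  map_mul' a b := by simp [single_mul_single]
  map_zero' := by simp
  map_add' a b := by simp

/-- The ring morphism `C ≀ G → D ≀ G`, `∑ y_σ σ ↦ ∑ f(y_σ) σ`, of a `G`-equivariant `f`. -/
def map (f : C →+* D) (hf : ∀ (σ : G) (c : C), f (σ • c) = σ • f c) :
    TwistedGroupRing C G →+* TwistedGroupRing D G :=
  liftNCRingHom (coeffHom.comp f) (of D G) (by
    intro c σ
    simp [coeffHom, of_apply, single_mul_single, hf])

theorem map_single (f : C →+* D) (hf : ∀ (σ : G) (c : C), f (σ • c) = σ • f c) (σ : G) (c : C) :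
    map f hf (single σ c) = single σ (f c) := by
  change liftNC _ _ (single σ c) = _
  simp [coeffHom, of_apply, single_mul_single]

end Map

section Incl

variable (S L G : Type*) [CommRing S] [CommRing L] [Algebra S L] [Group G]
  [MulSemiringAction G L] [SMulCommClass G S L]

/-- The inclusion `T ≀ G → L ≀ G`, where `T` is the integral closure of `S` in `L`. -/
def incl : TwistedGroupRing (integralClosure S L) G →+* TwistedGroupRing L G :=
  map (algebraMap (integralClosure S L) L) (fun _ _ => rfl)

end Incl

section Reduction

variable {S C G : Type*} [CommRing S] [CommRing C] [Algebra S C] [Group G]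
  [MulSemiringAction G C] [SMulCommClass G S C] (π : S)

/-- The ring `C / π C`. -/
abbrev Residue (C : Type*) [CommRing C] [Algebra S C] (π : S) : Type _ :=
  C ⧸ Ideal.span {algebraMap S C π}

theorem smul_mem_span (σ : G) (c : C) (hc : c ∈ Ideal.span {algebraMap S C π}) :
    σ • c ∈ Ideal.span {algebraMap S C π} := by
  obtain ⟨d, rfl⟩ := Ideal.mem_span_singleton'.1 hc
  refine Ideal.mem_span_singleton'.2 ⟨σ • d, ?_⟩
  rw [smul_mul', smul_algebraMap]

/-- The action of `σ ∈ G` on `C / π C` induced by its action on `C`. -/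
def residueMap (σ : G) : Residue C π →+* Residue C π :=
  Ideal.quotientMap _ (MulSemiringAction.toRingHom G C σ) (fun c hc => smul_mem_span π σ c hc)

/-- `G` acts on `C / π C` by `σ • (c mod π) = (σ • c) mod π`. -/
instance : MulSemiringAction G (Residue C π) where
  smul σ c := residueMap π σ c
  one_smul c := by
    obtain ⟨c, rfl⟩ := Ideal.Quotient.mk_surjective c
    exact congrArg _ (one_smul G c)
  mul_smul σ τ c := by
    obtain ⟨c, rfl⟩ := Ideal.Quotient.mk_surjective c
    exact congrArg _ (mul_smul σ τ c)
  smul_zero σ := map_zero (residueMap π σ)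
  smul_add σ := map_add (residueMap π σ)
  smul_one σ := map_one (residueMap π σ)
  smul_mul σ := map_mul (residueMap π σ)

theorem smul_mk (σ : G) (c : C) :
    σ • (Ideal.Quotient.mk (Ideal.span {algebraMap S C π}) c) =
      Ideal.Quotient.mk (Ideal.span {algebraMap S C π}) (σ • c) := rfl

variable (G C) in
/-- The reduction `C ≀ G → (C / π C) ≀ G`. -/
def red : TwistedGroupRing C G →+* TwistedGroupRing (Residue C π) G :=
  map (Ideal.Quotient.mk _) (fun σ c => (smul_mk π σ c).symm)

variable (G C) in
/-- The submodule `π M` of a `C ≀ G`-module `M`. -/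
def piSubmodule (M : Type*) [AddCommGroup M] [Module (TwistedGroupRing C G) M] :
    Submodule (TwistedGroupRing C G) M where
  carrier := {m | ∃ m' : M, m = algebraMap S (TwistedGroupRing C G) π • m'}
  zero_mem' := ⟨0, by simp⟩
  add_mem' := by
    rintro _ _ ⟨a, rfl⟩ ⟨b, rfl⟩
    exact ⟨a + b, by rw [smul_add]⟩
  smul_mem' := by
    rintro ξ _ ⟨a, rfl⟩
    exact ⟨ξ • a, by rw [← mul_smul, ← mul_smul, Algebra.commutes]⟩

variable (M : Type*) [AddCommGroup M] [Module (TwistedGroupRing C G) M]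

theorem coeffHom_smul_eq_zero (c : C) (hc : c ∈ Ideal.span {algebraMap S C π}) :
    ((Module.toAddMonoidEnd (TwistedGroupRing C G) (M ⧸ piSubmodule C G π M)).comp coeffHom) c
      = 0 := by
  obtain ⟨d, rfl⟩ := Ideal.mem_span_singleton'.1 hc
  ext m
  obtain ⟨m, rfl⟩ := Submodule.Quotient.mk_surjective _ m
  change (coeffHom (d * algebraMap S C π) : TwistedGroupRing C G) •
    (Submodule.Quotient.mk m : M ⧸ piSubmodule C G π M) = 0
  rw [← Submodule.Quotient.mk_smul, Submodule.Quotient.mk_eq_zero]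
  refine ⟨(coeffHom d : TwistedGroupRing C G) • m, ?_⟩
  rw [mul_comm, map_mul, mul_smul]
  rfl

/-- The operation of `(C / π C) ≀ G` on `M / π M`. -/
def residueAction :
    TwistedGroupRing (Residue C π) G →+* AddMonoid.End (M ⧸ piSubmodule C G π M) :=
  liftNCRingHom
    (Ideal.Quotient.lift _
      ((Module.toAddMonoidEnd (TwistedGroupRing C G) (M ⧸ piSubmodule C G π M)).comp coeffHom)
      (coeffHom_smul_eq_zero π M))
    ((Module.toAddMonoidEnd (TwistedGroupRing C G) (M ⧸ piSubmodule C G π M)).toMonoidHom.comp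
      (of C G)) (by
      intro c σ
      obtain ⟨c, rfl⟩ := Ideal.Quotient.mk_surjective c
      rw [smul_mk, Ideal.Quotient.lift_mk, Ideal.Quotient.lift_mk]
      change Module.toAddMonoidEnd (TwistedGroupRing C G) (M ⧸ piSubmodule C G π M)
          (coeffHom (σ • c)) *
        Module.toAddMonoidEnd (TwistedGroupRing C G) (M ⧸ piSubmodule C G π M) (of C G σ) =
        Module.toAddMonoidEnd (TwistedGroupRing C G) (M ⧸ piSubmodule C G π M) (of C G σ) *
        Module.toAddMonoidEnd (TwistedGroupRing C G) (M ⧸ piSubmodule C G π M) (coeffHom c)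
      rw [← map_mul, ← map_mul]
      congr 1
      simp [coeffHom, of_apply, single_mul_single])

/-- `M / π M` as a module over `(C / π C) ≀ G`. -/
instance : Module (TwistedGroupRing (Residue C π) G) (M ⧸ piSubmodule C G π M) :=
  Module.compHom _ (residueAction π M)

/-- The `(C / π C) ≀ G`-module structure of `M / π M` is the one induced by the `C ≀ G`-module
structure of `M`. -/
theorem red_smul_mk (ξ : TwistedGroupRing C G) (m : M) :
    red C G π ξ • (Submodule.Quotient.mk m : M ⧸ piSubmodule C G π M) =
      Submodule.Quotient.mk (ξ • m) := by
  suffices h : ((residueAction π M).comp (red C G π)).toAddMonoidHom =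
      (Module.toAddMonoidEnd (TwistedGroupRing C G) (M ⧸ piSubmodule C G π M)).toAddMonoidHom from
    DFunLike.congr_fun (DFunLike.congr_fun h ξ) (Submodule.Quotient.mk m)
  refine addHom_ext fun σ c => ?_
  change residueAction π M (red C G π (single σ c)) =
    Module.toAddMonoidEnd (TwistedGroupRing C G) (M ⧸ piSubmodule C G π M) (single σ c)
  rw [red, map_single]
  change liftNC _ _ (single σ _) = _
  rw [liftNC_single]
  change Module.toAddMonoidEnd (TwistedGroupRing C G) (M ⧸ piSubmodule C G π M) (coeffHom c) *
    Module.toAddMonoidEnd (TwistedGroupRing C G) (M ⧸ piSubmodule C G π M) (of C G σ) = _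
  rw [← map_mul]
  congr 1
  simp [coeffHom, of_apply, single_mul_single]

end Reduction

end TwistedGroupRing

/-- With `T` the integral closure of `S` in `L` and `T⁺ = {y ∈ L | Tr_{L/K}(y T) ⊆ S}` the trace dual
of `T`, this is the ideal `{z ∈ S | z T⁺ ⊆ T}`. If `(y_l)` is an `S`-basis of `T`, then `T⁺` has the
trace dual basis `(y_l^*)` as `S`-basis, so the condition says `z y_l^* ∈ T` for all `l`; hence the
exponent of this ideal is the largest elementary divisor exponent of the Gram matrix
`(Tr(y_l y_m))`. -/
def traceFormExponentIdeal (S K L : Type*) [CommRing S] [Field K] [Field L] [Algebra S K]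
    [Algebra K L] [Algebra S L] [IsScalarTower S K L] : Ideal S where
  carrier := {z | ∀ y ∈ Submodule.traceDual S K (1 : Submodule (integralClosure S L) L),
    z • y ∈ integralClosure S L}
  zero_mem' := fun y _ => by simp [zero_mem]
  add_mem' := fun ha hb y hy => by
    rw [add_smul]
    exact add_mem (ha y hy) (hb y hy)
  smul_mem' := fun c z hz y hy => by
    rw [smul_eq_mul, mul_smul]
    exact (integralClosure S L).smul_mem (hz y hy) c

end

/-! The proof runs on a Schur relation for the averaging operator `average`, φ ↦ ∑ b_i σ φ σ⁻¹
b_i^*, taken over σ ∈ G and a K-basis (b_i) of L with trace-dual basis (b_i^*). It lands in the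
commutant of L ≀ G and is a class function of φ, so on X it is φ ↦ s tr(φ) with s ∈ K. Testing on
multiplication by an element of L of trace 1 gives s m = n, where m = dim_L X = x/h. Hence x/g = m/n
= 1/s, and the valuation hypothesis says that π^t s is a unit of S.

Let v ∈ V lie outside πV. Some linear form f that is integral on V has f(v) = 1. For φ = f(·)v the
Schur relation gives s w for every w ∈ V, while expanding the average gives ∑ c_σ σ v, where Tr(c_σ
y) = f(σ⁻¹ y w). This trace is in S for y ∈ T, so c_σ ∈ T⁺ and π^t c_σ ∈ T. Thus π^t s w, and hence
w, lies in (T ≀ G)v. Every vector outside πV therefore generates V, and V/πV is simple, being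
nonzero by Nakayama. -/

open Module
open SkewMonoidAlgebra (single single_add smul_single single_mul_single coeffLinearEquiv)

/-! ### Galois theory of a non-faithful action -/

section GroupActionOnField

/-- The image of `G` in the automorphism group of `L` is a Galois group of `L` over `K`. -/
theorem isGaloisGroup_range_toAlgAut (G K L : Type*) [Group G] [Field K] [Field L] [Algebra K L]
    [MulSemiringAction G L] [SMulCommClass G K L] [Algebra.IsInvariant K L G] :
    IsGaloisGroup (MulSemiringAction.toAlgAut G K L).range K L where
  faithful := inferInstance
  commutes := inferInstance
  isInvariant := ⟨fun x hx => Algebra.IsInvariant.isInvariant (A := K) (G := G) x fun g =>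
    hx ⟨_, g, rfl⟩⟩

theorem finiteDimensional_of_isInvariant (G K L : Type*) [Group G] [Finite G] [Field K] [Field L]
    [Algebra K L] [MulSemiringAction G L] [SMulCommClass G K L] [Algebra.IsInvariant K L G] :
    FiniteDimensional K L :=
  have := isGaloisGroup_range_toAlgAut G K L
  have := Finite.of_surjective _ (MulSemiringAction.toAlgAut G K L).rangeRestrict_surjective
  IsGaloisGroup.finiteDimensional (MulSemiringAction.toAlgAut G K L).range K L

theorem isGalois_of_isInvariant (G K L : Type*) [Group G] [Finite G] [Field K] [Field L]
    [Algebra K L] [MulSemiringAction G L] [SMulCommClass G K L] [Algebra.IsInvariant K L G] :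
    IsGalois K L :=
  have := isGaloisGroup_range_toAlgAut G K L
  have := Finite.of_surjective _ (MulSemiringAction.toAlgAut G K L).rangeRestrict_surjective
  IsGaloisGroup.isGalois (MulSemiringAction.toAlgAut G K L).range K L

theorem card_ker_toRingAut_eq (G K L : Type*) [Group G] [Field K] [Field L] [Algebra K L]
    [MulSemiringAction G L] [SMulCommClass G K L] :
    Nat.card (MulSemiringAction.toRingAut G L).ker =
      Nat.card (MulSemiringAction.toAlgAut G K L).ker := by
  have : (MulSemiringAction.toRingAut G L).ker = (MulSemiringAction.toAlgAut G K L).ker := by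
    ext σ
    simp only [MonoidHom.mem_ker, RingEquiv.ext_iff, AlgEquiv.ext_iff]
    rfl
  rw [this]

variable (G K L : Type*) [Group G] [Finite G] [Field K] [Field L] [Algebra K L]
  [MulSemiringAction G L] [SMulCommClass G K L] [Algebra.IsInvariant K L G]

theorem toAlgAut_surjective_of_isInvariant :
    Function.Surjective (MulSemiringAction.toAlgAut G K L) := by
  have := isGaloisGroup_range_toAlgAut G K L
  have := finiteDimensional_of_isInvariant G K L
  have := isGalois_of_isInvariant G K L
  rw [← MonoidHom.range_eq_top]
  refine Subgroup.eq_top_of_card_eq _ ?_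
  rw [IsGaloisGroup.card_eq_finrank _ K L, IsGalois.card_aut_eq_finrank]

theorem card_eq_card_ker_mul_finrank :
    Nat.card G = Nat.card (MulSemiringAction.toRingAut G L).ker * Module.finrank K L := by
  have := finiteDimensional_of_isInvariant G K L
  have := isGalois_of_isInvariant G K L
  rw [card_ker_toRingAut_eq G K L, ← IsGalois.card_aut_eq_finrank,
    Subgroup.card_eq_card_quotient_mul_card_subgroup (MulSemiringAction.toAlgAut G K L).ker,
    Nat.card_congr (QuotientGroup.quotientKerEquivOfSurjective _
      (toAlgAut_surjective_of_isInvariant G K L)).toEquiv, mul_comm]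

/-- G maps onto Gal(L/K), and each automorphism has |N| preimages. -/
theorem sum_smul_eq_card_ker_mul_trace [Fintype G] (z : L) :
    ∑ σ : G, σ • z = algebraMap K L
      ((Nat.card (MulSemiringAction.toRingAut G L).ker : K) * Algebra.trace K L z) := by
  classical
  have := finiteDimensional_of_isInvariant G K L
  have := isGalois_of_isInvariant G K L
  let f := MulSemiringAction.toAlgAut G K L
  have hf : Function.Surjective f := toAlgAut_surjective_of_isInvariant G K L
  have hcard (e : Gal(L/K)) : (Finset.univ.filter fun σ => f σ = e).card =
      Nat.card (MulSemiringAction.toRingAut G L).ker := by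
    rw [MonoidHom.card_fiber_eq_of_mem_range f (hf e) ⟨1, map_one f⟩, card_ker_toRingAut_eq G K L,
      Nat.card_eq_fintype_card, Fintype.card_subtype]
    congr 1
    ext
    simp [f, MonoidHom.mem_ker]
  rw [map_mul, trace_eq_sum_automorphisms, map_natCast, Finset.mul_sum,
    ← Finset.sum_fiberwise Finset.univ f]
  refine Finset.sum_congr rfl fun e _ => ?_
  rw [← hcard e, ← nsmul_eq_mul]
  refine Finset.sum_eq_card_nsmul fun σ hσ => ?_
  rw [← (Finset.mem_filter.1 hσ).2]
  rfl

end GroupActionOnField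

/-! ### The Casimir element ∑ b_i ⊗ b_i^* of the trace form -/

section TraceDual

variable {K L E ι : Type*} [Field K] [Field L] [Algebra K L] [FiniteDimensional K L]
  [Algebra.IsSeparable K L] [Fintype ι] [DecidableEq ι] (b : Basis ι K L)
  [Ring E] [Algebra K E]

theorem Module.Basis.sum_trace_mul_traceDual (z : L) :
    ∑ i, Algebra.trace K L (z * b.traceDual i) • b i = z := by
  conv_rhs => rw [← b.sum_repr z]
  refine Finset.sum_congr rfl fun i _ => ?_
  have := b.traceDual.traceDual_repr_apply z i
  rw [Basis.traceDual_traceDual] at this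
  rw [this, Algebra.traceForm_apply]

theorem Module.Basis.sum_trace_mul_smul_traceDual (z : L) :
    ∑ i, Algebra.trace K L (z * b i) • b.traceDual i = z := by
  simpa using b.traceDual.sum_trace_mul_traceDual z

/-- The Casimir element is balanced: multiplication by z may be moved from one factor to the other.
The maps P and Q stand in for the tensor product. -/
theorem Module.Basis.sum_map_mul_mul_map_traceDual (P Q : L →ₗ[K] E) (z : L) :
    ∑ i, P (z * b i) * Q (b.traceDual i) = ∑ i, P (b i) * Q (z * b.traceDual i) := by
  have h1 (i : ι) : P (z * b i) * Q (b.traceDual i) =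
      ∑ j, Algebra.trace K L (z * b i * b.traceDual j) • (P (b j) * Q (b.traceDual i)) := by
    conv_lhs => rw [← b.sum_trace_mul_traceDual (z * b i)]
    simp [Finset.sum_mul]
  have h2 (j : ι) : P (b j) * Q (z * b.traceDual j) =
      ∑ i, Algebra.trace K L (z * b i * b.traceDual j) • (P (b j) * Q (b.traceDual i)) := by
    conv_lhs => rw [← b.sum_trace_mul_smul_traceDual (z * b.traceDual j)]
    simp [Finset.mul_sum, mul_right_comm]
  simp_rw [h1, h2]
  exact Finset.sum_comm

/-- Automorphisms preserve the trace form, so they carry dual bases to dual bases, and the Casimir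
element does not depend on the basis. -/
theorem Module.Basis.sum_map_algEquiv_mul_map_traceDual (P Q : L →ₗ[K] E) (e : L ≃ₐ[K] L) :
    ∑ i, P (e (b i)) * Q (e (b.traceDual i)) = ∑ i, P (b i) * Q (b.traceDual i) := by
  have ht (x y : L) : Algebra.trace K L (e x * y) = Algebra.trace K L (e.symm y * x) := by
    rw [← Algebra.trace_eq_of_algEquiv e (e.symm y * x), map_mul e, AlgEquiv.apply_symm_apply,
      mul_comm]
  have h1 (i : ι) : P (e (b i)) * Q (e (b.traceDual i)) =
      ∑ j, P (b j) * Q (e (Algebra.trace K L (e.symm (b.traceDual j) * b i) •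
        b.traceDual i)) := by
    conv_lhs => rw [← b.sum_trace_mul_traceDual (e (b i))]
    simp [Finset.sum_mul, ht]
  simp_rw [h1]
  rw [Finset.sum_comm]
  refine Finset.sum_congr rfl fun j _ => ?_
  rw [← Finset.mul_sum, ← map_sum, ← map_sum, b.sum_trace_mul_smul_traceDual,
    AlgEquiv.apply_symm_apply]

/-- Pairing the sum with z gives the matrix trace of multiplication by z, which is Tr(z · 1); the
trace form is nondegenerate. -/
theorem Module.Basis.sum_mul_traceDual : ∑ i, b i * b.traceDual i = 1 := by
  refine (LinearMap.ker_eq_bot.1 (LinearMap.separatingLeft_iff_ker_eq_bot.1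
    (traceForm_nondegenerate K L).1)) (LinearMap.ext fun z => ?_)
  rw [Algebra.traceForm_apply, Algebra.traceForm_apply, one_mul, Algebra.trace_eq_matrix_trace b z,
    Matrix.trace, Finset.sum_mul, map_sum]
  refine Finset.sum_congr rfl fun i _ => ?_
  have := b.traceDual.traceDual_repr_apply (z * b i) i
  rw [Basis.traceDual_traceDual] at this
  rw [Matrix.diag_apply, Algebra.leftMulMatrix_eq_repr_mul, this, Algebra.traceForm_apply]
  congr 1
  ring

end TraceDual

/-! ### Traces of endomorphisms -/

theorem LinearMap.exists_eq_smul_trace {K X : Type*} [Field K] [AddCommGroup X] [Module K X]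
    [FiniteDimensional K X] (c : End K X →ₗ[K] K) (hc : ∀ φ ψ, c (φ * ψ) = c (ψ * φ)) :
    ∃ s : K, c = s • LinearMap.trace K X := by
  -- On rank-one maps, invariance under swapping factors forces the value at k(·)y to be
  -- proportional to k(y).
  have hrank (f k : Dual K X) (y u : X) :
      f u * c (k.smulRight y) = k y * c (f.smulRight u) := by
    have h := hc (f.smulRight y) (k.smulRight u)
    have h1 : f.smulRight y * k.smulRight u = f u • k.smulRight y := by
      ext x; simp [smul_smul, mul_comm]
    have h2 : k.smulRight u * f.smulRight y = k y • f.smulRight u := by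
      ext x; simp [smul_smul, mul_comm]
    rw [h1, h2, map_smul, map_smul] at h
    exact h
  obtain _ | _ := subsingleton_or_nontrivial X
  · exact ⟨0, LinearMap.ext fun φ => by rw [Subsingleton.elim φ 0]; simp⟩
  obtain ⟨u, hu⟩ := exists_ne (0 : X)
  obtain ⟨f, hf⟩ := Projective.exists_dual_eq_one K hu
  refine ⟨c (f.smulRight u), LinearMap.ext fun φ => ?_⟩
  let e := finBasis K X
  have hφ : φ = ∑ i, (e.coord i).smulRight (φ (e i)) := by
    refine e.ext fun j => ?_
    simp [LinearMap.sum_apply, Finsupp.single_apply, ite_smul]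
  rw [hφ, map_sum, map_sum]
  refine Finset.sum_congr rfl fun i _ => ?_
  have := hrank f (e.coord i) (φ (e i)) u
  rw [hf, one_mul] at this
  rw [this, LinearMap.smul_apply, LinearMap.trace_smulRight, smul_eq_mul, mul_comm]

/-- In a tower basis, z acts by dim_L X diagonal copies of its multiplication matrix on L. -/
theorem LinearMap.trace_eq_finrank_mul_trace {K L X : Type*} [Field K] [Field L] [Algebra K L]
    [FiniteDimensional K L] [AddCommGroup X] [Module K X] [Module L X] [IsScalarTower K L X]
    [FiniteDimensional L X] (z : L) :
    LinearMap.trace K X (Algebra.lsmul K K X z) = finrank L X * Algebra.trace K L z := by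
  classical
  let b := finBasis K L
  let e := finBasis L X
  rw [LinearMap.trace_eq_matrix_trace K (b.smulTower e), Algebra.trace_eq_matrix_trace b,
    Matrix.trace, Matrix.trace, Fintype.sum_prod_type_right]
  simp [LinearMap.toMatrix_apply, Basis.smulTower_repr, Basis.smulTower_apply, smul_smul,
    Algebra.leftMulMatrix_eq_repr_mul]

/-! ### The averaging operator -/

namespace TwistedGroupRing

section Averaging

variable {G K L ι : Type*} [Group G] [Field K] [Field L] [Algebra K L]
  [MulSemiringAction G L] [SMulCommClass G K L]

/-- `y ↦ y σ` as a `K`-linear map `L → L ≀ G`. -/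
noncomputable def singleLinear (K : Type*) [Field K] [Algebra K L] [SMulCommClass G K L] (σ : G) :
    L →ₗ[K] TwistedGroupRing L G where
  toFun := single σ
  map_add' _ _ := single_add _ _ _
  map_smul' c y := (smul_single c σ y).symm

/-- `y ↦ σ⁻¹ y` as a `K`-linear map `L → L ≀ G`. -/
noncomputable def invSingleLinear (K : Type*) [Field K] [Algebra K L] [SMulCommClass G K L]
    (σ : G) : L →ₗ[K] TwistedGroupRing L G where
  toFun y := single σ⁻¹ (σ⁻¹ • y)
  map_add' _ _ := by rw [smul_add, single_add]
  map_smul' c y := by rw [smul_comm, ← smul_single, RingHom.id_apply]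

variable [Fintype G] [FiniteDimensional K L] [Algebra.IsSeparable K L] [Fintype ι] [DecidableEq ι]
  {E : Type*} [Ring E] [Algebra K E] (ρ : TwistedGroupRing L G →ₐ[K] E) (b : Basis ι K L)

/-- The averaging operator `φ ↦ ∑_σ ∑_i (b_i σ) φ (σ⁻¹ b_i^*)` of a representation of `L ≀ G`. -/
noncomputable def average : E →ₗ[K] E :=
  ∑ σ : G, ∑ i, LinearMap.mulLeftRight K (ρ (single σ (b i)),
    ρ (single σ⁻¹ (σ⁻¹ • b.traceDual i)))

theorem average_apply (φ : E) : average ρ b φ =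
    ∑ σ : G, ∑ i, ρ (single σ (b i)) * φ * ρ (single σ⁻¹ (σ⁻¹ • b.traceDual i)) := by
  simp [average, LinearMap.sum_apply]

/-- Reindexing σ to στ absorbs τ; the balanced Casimir element then moves σ(z) to the left. -/
theorem average_mul_single (φ : E) (τ : G) (z : L) :
    average ρ b (φ * ρ (single τ z)) = average ρ b (ρ (single τ z) * φ) := by
  rw [average_apply, average_apply, ← Equiv.sum_comp (Equiv.mulRight τ)]
  refine Finset.sum_congr rfl fun σ _ => ?_
  have := b.sum_map_mul_mul_map_traceDual (ρ.toLinearMap ∘ₗ singleLinear K (σ * τ))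
    (LinearMap.mulLeft K φ ∘ₗ ρ.toLinearMap ∘ₗ invSingleLinear K σ) (σ • z)
  convert this.symm using 1
  · refine Finset.sum_congr rfl fun i _ => ?_
    simp [singleLinear, invSingleLinear, mul_assoc, ← map_mul, single_mul_single, smul_smul]
  · refine Finset.sum_congr rfl fun i _ => ?_
    simp only [LinearMap.comp_apply, singleLinear, invSingleLinear, LinearMap.coe_mk,
      AddHom.coe_mk, AlgHom.toLinearMap_apply, LinearMap.mulLeft_apply]
    rw [mul_assoc, mul_assoc, ← mul_assoc (ρ _) (ρ _), ← map_mul, single_mul_single, mul_comm (b i)]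

/-- After reindexing σ to τ⁻¹σ, the pair of dual bases is transported by τ, which changes nothing,
and z passes across by balancedness. -/
theorem single_mul_average (φ : E) (τ : G) (z : L) :
    ρ (single τ z) * average ρ b φ = average ρ b φ * ρ (single τ z) := by
  rw [average_apply, Finset.mul_sum, Finset.sum_mul, ← Equiv.sum_comp (Equiv.mulLeft τ⁻¹)]
  refine Finset.sum_congr rfl fun σ _ => ?_
  have h1 := b.sum_map_algEquiv_mul_map_traceDual
    (ρ.toLinearMap ∘ₗ singleLinear K σ ∘ₗ LinearMap.mulLeft K z)
    (LinearMap.mulLeft K φ ∘ₗ LinearMap.mulRight K (ρ (single τ 1)) ∘ₗ ρ.toLinearMap ∘ₗ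
      invSingleLinear K σ)
    (MulSemiringAction.toAlgAut G K L τ)
  have h2 := b.sum_map_mul_mul_map_traceDual (ρ.toLinearMap ∘ₗ singleLinear K σ)
    (LinearMap.mulLeft K φ ∘ₗ LinearMap.mulRight K (ρ (single τ 1)) ∘ₗ ρ.toLinearMap ∘ₗ
      invSingleLinear K σ) z
  convert h1.trans h2 using 1
  · rw [Finset.mul_sum]
    refine Finset.sum_congr rfl fun i _ => ?_
    simp [singleLinear, invSingleLinear, mul_assoc, ← map_mul, single_mul_single, smul_smul]
    simp [← mul_assoc, ← map_mul, single_mul_single]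
  · rw [Finset.sum_mul]
    refine Finset.sum_congr rfl fun i _ => ?_
    simp [singleLinear, invSingleLinear, mul_assoc, ← map_mul, single_mul_single, mul_comm]

theorem mul_average (φ : E) (a : TwistedGroupRing L G) :
    ρ a * average ρ b φ = average ρ b φ * ρ a := by
  induction a using SkewMonoidAlgebra.induction_on with
  | zero => simp
  | single τ z => exact single_mul_average ρ b φ τ z
  | add a a' h h' => rw [map_add, add_mul, mul_add, h, h']

theorem average_mul_comm (φ : E) (a : TwistedGroupRing L G) :
    average ρ b (φ * ρ a) = average ρ b (ρ a * φ) := by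
  induction a using SkewMonoidAlgebra.induction_on with
  | zero => simp
  | single τ z => exact average_mul_single ρ b φ τ z
  | add a a' h h' => rw [map_add, add_mul, mul_add, map_add, map_add, h, h']

theorem average_coeffHom (z : L) :
    average ρ b (ρ (coeffHom z)) = ρ (coeffHom (∑ σ : G, σ • z)) := by
  rw [average_apply, map_sum, map_sum]
  refine Finset.sum_congr rfl fun σ _ => ?_
  have h (i : ι) : ρ (single σ (b i)) * ρ (coeffHom z) *
      ρ (single σ⁻¹ (σ⁻¹ • b.traceDual i)) =
      ρ (coeffHom (σ • z * (b i * b.traceDual i))) := by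
    rw [← map_mul, ← map_mul]
    congr 1
    simp [coeffHom, single_mul_single, mul_comm, mul_left_comm]
  simp_rw [h]
  rw [← map_sum, ← map_sum, ← Finset.mul_sum, b.sum_mul_traceDual, mul_one]

end Averaging

end TwistedGroupRing

theorem SkewMonoidAlgebra.finite_of_finite (R C G : Type*) [Semiring R] [AddCommMonoid C]
    [Module R C] [Module.Finite R C] [Finite G] : Module.Finite R (SkewMonoidAlgebra C G) :=
  Module.Finite.equiv (coeffLinearEquiv (S := R) (k := C) (G := G)).symm

/-! ### Simple modules with endomorphism ring K -/

section Density

variable {K A X : Type*} [Field K] [Ring A] [Algebra K A] [AddCommGroup X] [Module A X]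
  [Module K X] [IsScalarTower K A X]

theorem finrank_end_eq_finrank [Nontrivial X]
    (hEnd : ∀ f : End A X, ∃ c : K, ∀ x : X, f x = c • x) :
    finrank (End A X) X = finrank K X := by
  refine congrArg Cardinal.toNat (rank_eq_of_equiv_equiv (algebraMap K (End A X)) (AddEquiv.refl X)
    ⟨(algebraMap K (End A X)).injective, fun f => ?_⟩ fun _ _ => rfl).symm
  obtain ⟨c, hc⟩ := hEnd f
  exact ⟨c, LinearMap.ext fun x => (hc x).symm⟩

/-- Jacobson density over the commutant K, applied to a finite K-basis of X. -/
theorem lsmul_surjective_of_end_eq [IsSimpleModule A X] [FiniteDimensional K X]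
    (hEnd : ∀ f : End A X, ∃ c : K, ∀ x : X, f x = c • x) :
    Function.Surjective (Algebra.lsmul K K X : A →ₐ[K] End K X) := by
  classical
  intro φ
  let φ' : End (End A X) X :=
    { toFun := φ
      map_add' := map_add φ
      map_smul' := fun f x => by
        obtain ⟨c, hc⟩ := hEnd f
        simp [hc] }
  let e := finBasis K X
  obtain ⟨a, ha⟩ := jacobson_density φ' (Finset.univ.image e)
  exact ⟨a, e.ext fun i => (ha (e i) (by simp)).symm⟩

theorem finite_of_isSimpleModule [Module.Finite K A] [IsSimpleModule A X] :
    FiniteDimensional K X :=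
  have := IsSimpleModule.nontrivial A X
  have ⟨x, hx⟩ := exists_ne (0 : X)
  Module.Finite.of_surjective ((LinearMap.toSpanSingleton A X x).restrictScalars K)
    (IsSimpleModule.toSpanSingleton_surjective A hx)

end Density

/-- A primitive vector of a full lattice over a discrete valuation ring has value `1` under some
linear form that is integral on the lattice. -/
theorem exists_dual_eq_one_of_notMem_smul {S K X : Type*} [CommRing S] [IsDomain S]
    [IsDiscreteValuationRing S] [Field K] [Algebra S K] [IsFractionRing S K] [AddCommGroup X]
    [Module K X] [Module S X] [IsScalarTower S K X] {π : S} (hπ : Irreducible π)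
    (W : Submodule S X) [Module.Finite S W] (hW : Submodule.span K (W : Set X) = ⊤) (v : W)
    (hv : ∀ w : W, v ≠ π • w) :
    ∃ f : Dual K X, f v = 1 ∧ ∀ w : W, f w ∈ (algebraMap S K).range := by
  have : IsTorsionFree S X := IsTorsionFree.trans_faithfulSMul S K X
  have : Module.Free S W := Module.free_of_finite_type_torsion_free'
  let e := Module.Free.chooseBasis S W
  have hli : LinearIndependent K fun i => (e i : X) :=
    (LinearIndependent.iff_fractionRing S K).1
      (e.linearIndependent.map' W.subtype W.ker_subtype)
  have hrepr (w : W) : (w : X) = ∑ i, algebraMap S K (e.repr w i) • (e i : X) := by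
    have h := congrArg W.subtype (e.sum_repr w)
    rw [map_sum] at h
    exact h.symm.trans (Finset.sum_congr rfl fun i _ => (algebraMap_smul K _ _).symm)
  have hsp : ⊤ ≤ Submodule.span K (Set.range fun i => (e i : X)) := by
    rw [← hW, Submodule.span_le]
    intro w hw
    rw [SetLike.mem_coe, show w = _ from hrepr ⟨w, hw⟩]
    exact Submodule.sum_mem _ fun i _ => Submodule.smul_mem _ _ (Submodule.subset_span ⟨i, rfl⟩)
  let e' : Basis _ K X := Basis.mk hli hsp
  have hcoord (w : W) (i) : e'.coord i w = algebraMap S K (e.repr w i) := by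
    have he' (j) : (e j : X) = e' j := by simp [e']
    rw [hrepr w, map_sum]
    simp [he', Finsupp.single_apply, Algebra.smul_def]
  -- If every coordinate were a nonunit, π would divide v in W.
  have hunit : ∃ i, IsUnit (e.repr v i) := by
    by_contra! h
    have hdvd (i) : π ∣ e.repr v i := by
      rw [← Ideal.mem_span_singleton, ← (IsDiscreteValuationRing.irreducible_iff_uniformizer π).1 hπ]
      exact h i
    choose c hc using hdvd
    refine hv (∑ i, c i • e i) ?_
    conv_lhs => rw [← e.sum_repr v]
    rw [Finset.smul_sum]
    exact Finset.sum_congr rfl fun i _ => by rw [hc i, mul_smul]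
  obtain ⟨i, u, hu⟩ := hunit
  refine ⟨algebraMap S K ↑u⁻¹ • e'.coord i, ?_, fun w => ⟨↑u⁻¹ * e.repr w i, ?_⟩⟩
  · rw [LinearMap.smul_apply, hcoord, ← hu, smul_eq_mul, ← map_mul, Units.inv_mul, map_one]
  · rw [LinearMap.smul_apply, hcoord, map_mul, smul_eq_mul]

namespace TwistedGroupRing

/-! ### The Schur element -/

section SchurElement

variable {G K L ι : Type*} [Group G] [Fintype G] [Field K] [Field L] [Algebra K L]
  [MulSemiringAction G L] [SMulCommClass G K L] [Algebra.IsInvariant K L G]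
  [FiniteDimensional K L] [Algebra.IsSeparable K L] [Fintype ι] [DecidableEq ι] (b : Basis ι K L)
  {X : Type*} [AddCommGroup X] [Module (TwistedGroupRing L G) X]
  [IsSimpleModule (TwistedGroupRing L G) X] [Module K X]
  [IsScalarTower K (TwistedGroupRing L G) X]

/-- On a simple module `X` with endomorphism ring `K`, averaging `φ` gives the scalar `s • tr φ`,
where the Schur element `s` satisfies `s * dim_L X = |N|`. -/
theorem exists_average_eq_smul_trace
    (hEnd : ∀ f : End (TwistedGroupRing L G) X, ∃ c : K, ∀ x : X, f x = c • x) :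
    ∃ (m : ℕ) (s : K), finrank K X = finrank K L * m ∧
      s * m = Nat.card (MulSemiringAction.toRingAut G L).ker ∧
      ∀ φ : End K X, average (Algebra.lsmul K K X : TwistedGroupRing L G →ₐ[K] End K X) b φ =
        (s * LinearMap.trace K X φ) • 1 := by
  have := SkewMonoidAlgebra.finite_of_finite K L G
  have : FiniteDimensional K X := finite_of_isSimpleModule (A := TwistedGroupRing L G)
  have := IsSimpleModule.nontrivial (TwistedGroupRing L G) X
  obtain ⟨u, hu⟩ := exists_ne (0 : X)
  obtain ⟨f, hf⟩ := Projective.exists_dual_eq_one K hu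
  let ρ : TwistedGroupRing L G →ₐ[K] End K X := Algebra.lsmul K K X
  -- Averages are scalar because they commute with L ≀ G; since f(u) = 1, this form reads off the
  -- scalar.
  let c : End K X →ₗ[K] K := f ∘ₗ LinearMap.applyₗ u ∘ₗ average ρ b
  have hc (φ : End K X) : average ρ b φ = c φ • 1 := by
    obtain ⟨d, hd⟩ := hEnd
      { toFun := average ρ b φ
        map_add' := map_add _
        map_smul' := fun a x => (LinearMap.congr_fun (mul_average ρ b φ a) x).symm }
    have hd' : average ρ b φ = d • 1 := LinearMap.ext hd
    have : c φ = d := by simp [c, hd', hf]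
    rw [this, hd']
  obtain ⟨s, hs⟩ := LinearMap.exists_eq_smul_trace c fun φ ψ => by
    obtain ⟨a, rfl⟩ := lsmul_surjective_of_end_eq hEnd ψ
    exact congrArg (fun η : End K X => f (η u)) (average_mul_comm ρ b φ a)
  let _ : Module L X := Module.compHom X (coeffHom : L →+* TwistedGroupRing L G)
  have : IsScalarTower K L X := IsScalarTower.of_algebraMap_smul fun k x =>
    algebraMap_smul (TwistedGroupRing L G) k x
  have : FiniteDimensional L X := Module.Finite.of_restrictScalars_finite K L X
  refine ⟨finrank L X, s, (finrank_mul_finrank K L X).symm, ?_, fun φ => ?_⟩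
  · obtain ⟨z, hz⟩ := Algebra.trace_surjective K L 1
    have h1 : c (ρ (coeffHom z)) = s * finrank L X := by
      have : ρ (coeffHom z) = Algebra.lsmul K K X z := rfl
      rw [hs, this, LinearMap.smul_apply, LinearMap.trace_eq_finrank_mul_trace, hz, mul_one,
        smul_eq_mul]
    have h2 := hc (ρ (coeffHom z))
    rw [average_coeffHom, sum_smul_eq_card_ker_mul_trace G K L, hz, mul_one, h1] at h2
    have h3 := congrArg f (LinearMap.congr_fun h2 u)
    have h4 (k : K) : ρ (coeffHom (algebraMap K L k)) u = k • u :=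
      algebraMap_smul (TwistedGroupRing L G) k u
    rw [h4, LinearMap.smul_apply, End.one_apply, map_smul, map_smul, hf] at h3
    simpa using h3.symm
  · exact (hc φ).trans (by rw [hs]; rfl)

end SchurElement

end TwistedGroupRing

/-! ### From the valuation hypothesis to a unit of S -/

theorem IsDiscreteValuationRing.valuation_pow_eq_exp {S : Type*} (K : Type*) [CommRing S]
    [IsDomain S] [IsDiscreteValuationRing S] [Field K] [Algebra S K] [IsFractionRing S K] {π : S}
    (hπ : Irreducible π) (t : ℕ) :
    (maximalIdeal S).valuation K (algebraMap S K (π ^ t)) = WithZero.exp (-(t : ℤ)) := by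
  rw [IsDedekindDomain.HeightOneSpectrum.valuation_of_algebraMap, map_pow,
    (maximalIdeal S).intValuation_singleton hπ.ne_zero
      ((IsDiscreteValuationRing.irreducible_iff_uniformizer π).1 hπ), ← WithZero.exp_nsmul]
  simp

theorem IsDiscreteValuationRing.exists_units_of_valuation_ratCast_eq {S K : Type*} [CommRing S]
    [IsDomain S] [IsDiscreteValuationRing S] [Field K] [Algebra S K] [IsFractionRing S K] {π : S}
    (hπ : Irreducible π) {t m n : ℕ} {s : K} (hn : (n : K) ≠ 0) (hs : s * m = n)
    (hv : (maximalIdeal S).valuation K (((m : ℚ) / (n : ℚ) : ℚ) : K) = WithZero.exp (-(t : ℤ))) :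
    ∃ u : Sˣ, algebraMap S K (π ^ t) * s = algebraMap S K u := by
  rw [Rat.cast_div_of_ne_zero (by simp) (by simpa using hn), Rat.cast_natCast,
    Rat.cast_natCast, ← valuation_pow_eq_exp K hπ] at hv
  obtain ⟨u, hu⟩ := associated_of_valuation_eq (A := S) _ _ hv
  refine ⟨u, ?_⟩
  rw [← hu, Units.smul_def, Algebra.smul_def, mul_assoc, div_mul_eq_mul_div, mul_comm (m : K), hs,
    div_self hn, mul_one]

namespace TwistedGroupRing

/-! ### Fourier inversion on lattices -/

section Lattice

variable {G K L S : Type*} [Group G] [Field K] [Field L] [Algebra K L]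
  [MulSemiringAction G L] [SMulCommClass G K L] [CommRing S] [Algebra S K]
  [Algebra S L] [IsScalarTower S K L] [SMulCommClass G S L]

theorem incl_single (σ : G) (y : integralClosure S L) :
    incl S L G (single σ y) = single σ (y : L) :=
  map_single _ _ σ y

variable {X : Type*} [AddCommGroup X] [Module (TwistedGroupRing L G) X] [Module K X]
  [IsScalarTower K (TwistedGroupRing L G) X] [Module (TwistedGroupRing (integralClosure S L) G) X]

theorem isScalarTower_of_incl_smul [Module S X] [IsScalarTower S K X]
    (hX : ∀ (ξ : TwistedGroupRing (integralClosure S L) G) (x : X), ξ • x = incl S L G ξ • x) :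
    IsScalarTower S (TwistedGroupRing (integralClosure S L) G) X :=
  IsScalarTower.of_algebraMap_smul fun c x => by
    rw [hX, ← algebraMap_smul K c x, ← algebraMap_smul (TwistedGroupRing L G) (algebraMap S K c) x]
    congr 1
    rw [SkewMonoidAlgebra.coe_algebraMap, SkewMonoidAlgebra.coe_algebraMap, Function.comp_apply,
      Function.comp_apply, incl_single, ← IsScalarTower.algebraMap_apply]
    rfl

variable [Fintype G] [FiniteDimensional K L] [Algebra.IsSeparable K L] {ι : Type*} [Fintype ι]
  [DecidableEq ι] (b : Basis ι K L)

/-- Fourier inversion of the operator `x ↦ f(x) v` on a lattice stable under `T ≀ G`. -/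
theorem exists_smul_eq_smul_average [Module S X] [IsScalarTower S K X]
    (hX : ∀ (ξ : TwistedGroupRing (integralClosure S L) G) (x : X), ξ • x = incl S L G ξ • x)
    {z : S} (hz : z ∈ traceFormExponentIdeal S K L)
    (V : Submodule (TwistedGroupRing (integralClosure S L) G) X) (f : Dual K X)
    (hf : ∀ w ∈ V, f w ∈ (algebraMap S K).range) (v : X) {w : X} (hw : w ∈ V) :
    ∃ ξ : TwistedGroupRing (integralClosure S L) G,
      ξ • v = z • average (Algebra.lsmul K K X : TwistedGroupRing L G →ₐ[K] End K X) b
        (f.smulRight v) w := by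
  let q (σ : G) : L →ₗ[K] K := f ∘ₗ LinearMap.applyₗ w ∘ₗ
    (Algebra.lsmul K K X : TwistedGroupRing L G →ₐ[K] End K X).toLinearMap ∘ₗ invSingleLinear K σ
  have hq (σ : G) (y : L) : q σ y = f ((single σ⁻¹ (σ⁻¹ • y) : TwistedGroupRing L G) • w) := rfl
  -- The element representing the functional q σ under the trace form.
  let c (σ : G) : L := ∑ i, q σ (b.traceDual i) • b i
  have htrace (σ : G) (y : L) : Algebra.trace K L (c σ * y) = q σ y := by
    conv_rhs => rw [← b.sum_trace_mul_smul_traceDual y]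
    simp only [c, Finset.sum_mul, map_sum, smul_mul_assoc, map_smul, smul_eq_mul]
    exact Finset.sum_congr rfl fun i _ => by rw [mul_comm (b i), mul_comm]
  -- V is stable under T ≀ G and f is integral on V, so c σ lies in T⁺; z then brings it into T.
  have hc (σ : G) : z • c σ ∈ integralClosure S L := by
    refine hz _ ((Submodule.mem_traceDual).2 fun a ha => ?_)
    obtain ⟨y, rfl⟩ := Submodule.mem_one.1 ha
    rw [Algebra.traceForm_apply, htrace, hq]
    have : (single σ⁻¹ (σ⁻¹ • algebraMap (integralClosure S L) L y) : TwistedGroupRing L G) • w =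
        (single σ⁻¹ (σ⁻¹ • y) : TwistedGroupRing (integralClosure S L) G) • w := by
      rw [hX, incl_single]
      rfl
    rw [this]
    exact hf _ (V.smul_mem _ hw)
  refine ⟨∑ σ : G, single σ ⟨z • c σ, hc σ⟩, ?_⟩
  rw [hX, map_sum, Finset.sum_smul, average_apply, LinearMap.sum_apply, Finset.smul_sum]
  refine Finset.sum_congr rfl fun σ _ => ?_
  have hterm (i : ι) : ((Algebra.lsmul K K X : TwistedGroupRing L G →ₐ[K] End K X)
        (single σ (b i)) * f.smulRight v * (Algebra.lsmul K K X : TwistedGroupRing L G →ₐ[K] _)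
          (single σ⁻¹ (σ⁻¹ • b.traceDual i))) w =
      singleLinear K σ (q σ (b.traceDual i) • b i) • v := by
    rw [map_smul, smul_assoc, End.mul_apply, End.mul_apply, LinearMap.smulRight_apply, map_smul]
    rfl
  have hcoeff : (single σ (z • c σ) : TwistedGroupRing L G) =
      algebraMap S K z • singleLinear K σ (c σ) := by
    rw [← map_smul, algebraMap_smul]
    rfl
  rw [incl_single, LinearMap.sum_apply, Finset.sum_congr rfl fun i _ => hterm i,
    ← Finset.sum_smul, ← map_sum,
    ← algebraMap_smul K z (singleLinear K σ _ • v), ← smul_assoc]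
  exact congrArg (· • v) hcoeff

end Lattice

end TwistedGroupRing

/-! ### Simplicity of the reduction -/

theorem mainTheorem4
    -- a finite group `G` acting on a field `L` with fixed field `K`
    {G K L : Type*} [Group G] [Finite G] [Field K] [Field L] [Algebra K L]
    [MulSemiringAction G L] [SMulCommClass G K L] [Algebra.IsInvariant K L G]
    -- the order of the kernel `N` of the action is invertible in `K`
    (hn : (Nat.card (MulSemiringAction.toRingAut G L).ker : K) ≠ 0)
    -- a discrete valuation ring `S` with field of fractions `K` and uniformizer `π`;
    -- its integral closure in `L` is `T = integralClosure S L`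
    {S : Type*} [CommRing S] [IsDomain S] [IsDiscreteValuationRing S] [Algebra S K]
    [IsFractionRing S K] [Algebra S L] [IsScalarTower S K L] [SMulCommClass G S L]
    (π : S) (hπ : Irreducible π)
    -- `S π ^ t = {z ∈ S | z T⁺ ⊆ T}`
    (t : ℕ) (ht : traceFormExponentIdeal S K L = Ideal.span {π ^ t})
    -- a simple `L ≀ G`-module `X`, with the `K`- and `T ≀ G`-module structures it restricts to
    {X : Type*} [AddCommGroup X] [Module (TwistedGroupRing L G) X]
    [IsSimpleModule (TwistedGroupRing L G) X]
    [Module K X] [IsScalarTower K (TwistedGroupRing L G) X]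
    [Module (TwistedGroupRing (integralClosure S L) G) X]
    (hX : ∀ (ξ : TwistedGroupRing (integralClosure S L) G) (x : X),
      ξ • x = TwistedGroupRing.incl S L G ξ • x)
    -- the endomorphism ring of `X` is `K`
    (hEnd : ∀ f : Module.End (TwistedGroupRing L G) X, ∃ c : K, ∀ x : X, f x = c • x)
    -- `v (x / g) = t`, where `x` is the dimension of `X` over its endomorphism ring, `g = |G|`
    (hv : (IsDiscreteValuationRing.maximalIdeal S).valuation K
        (((Module.finrank (Module.End (TwistedGroupRing L G) X) X : ℚ) / (Nat.card G : ℚ) : ℚ) : K)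
      = WithZero.exp (-(t : ℤ)))
    -- a full `T ≀ G`-lattice `V` in `X`
    (V : Submodule (TwistedGroupRing (integralClosure S L) G) X) (hV : V.FG)
    (hKV : Submodule.span K (V : Set X) = ⊤) :
    -- `V / π V` is a simple module over `(T / π T) ≀ G`
    IsSimpleModule
      (TwistedGroupRing (TwistedGroupRing.Residue (integralClosure S L) π) G)
      (V ⧸ TwistedGroupRing.piSubmodule (integralClosure S L) G π V) := by
  classical
  cases nonempty_fintype G
  have := finiteDimensional_of_isInvariant G K L
  have := isGalois_of_isInvariant G K L
  have := IsSimpleModule.nontrivial (TwistedGroupRing L G) X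
  let _ : Module S X := Module.compHom X (algebraMap S K)
  have : IsScalarTower S K X := IsScalarTower.of_algebraMap_smul fun _ _ => rfl
  have := TwistedGroupRing.isScalarTower_of_incl_smul (K := K) hX
  have : Module.Finite S (integralClosure S L) := IsIntegralClosure.finite S K L _
  have : Module.Finite S (TwistedGroupRing (integralClosure S L) G) :=
    SkewMonoidAlgebra.finite_of_finite S _ G
  have : Module.Finite (TwistedGroupRing (integralClosure S L) G) V := Module.Finite.iff_fg.2 hV
  have : Module.Finite S V := Module.Finite.trans (TwistedGroupRing (integralClosure S L) G) V
  have : Module.Finite S (V.restrictScalars S) := this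
  let b := finBasis K L
  obtain ⟨m, s, hm, hs, haverage⟩ :=
    TwistedGroupRing.exists_average_eq_smul_trace (G := G) b hEnd
  have : FiniteDimensional K X :=
    have := SkewMonoidAlgebra.finite_of_finite K L G
    finite_of_isSimpleModule (A := TwistedGroupRing L G)
  -- Since x = h m and g = n h, the quotient is m/n. The factor h is cancelled in ℚ, where it is
  -- nonzero whatever the characteristic of K.
  rw [finrank_end_eq_finrank hEnd, hm, card_eq_card_ker_mul_finrank G K L, mul_comm, Nat.cast_mul,
    Nat.cast_mul, mul_div_mul_right _ _ (Nat.cast_ne_zero.2 finrank_pos.ne')] at hv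
  obtain ⟨u, hu⟩ := IsDiscreteValuationRing.exists_units_of_valuation_ratCast_eq hπ hn hs hv
  -- Both expressions for the average of f(·)v, scaled by π^t, give ξ v = u w with u a unit.
  have htransitive (v : V) (hv : v ∉ TwistedGroupRing.piSubmodule (integralClosure S L) G π V)
      (w : V) : ∃ ξ : TwistedGroupRing (integralClosure S L) G, ξ • v = w := by
    obtain ⟨f, hfv, hf⟩ := exists_dual_eq_one_of_notMem_smul hπ (V.restrictScalars S) hKV v
      fun w hw => hv ⟨w, hw.trans (algebraMap_smul _ π w).symm⟩
    obtain ⟨ξ, hξ⟩ := TwistedGroupRing.exists_smul_eq_smul_average b hX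
      (ht ▸ Ideal.mem_span_singleton_self (π ^ t)) V f (fun w hw => hf ⟨w, hw⟩) v w.2
    refine ⟨(↑u⁻¹ : S) • ξ, Subtype.ext ?_⟩
    rw [haverage, LinearMap.trace_smulRight, hfv, mul_one, LinearMap.smul_apply, End.one_apply,
      ← algebraMap_smul K (π ^ t), smul_smul, hu, algebraMap_smul] at hξ
    rw [smul_assoc, Submodule.coe_smul_of_tower, Submodule.coe_smul, hξ, smul_smul, Units.inv_mul,
      one_smul]
  rw [isSimpleModule_iff_toSpanSingleton_surjective]
  refine ⟨?_, fun v hv w => ?_⟩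
  · rw [Submodule.Quotient.nontrivial_iff]
    intro htop
    -- Nakayama: V = πV would force V = 0, contradicting KV = X ≠ 0.
    have hbot : (⊤ : Submodule S V) = ⊥ := by
      refine Submodule.eq_bot_of_le_smul_of_le_jacobson_bot (Ideal.span {π}) _ Module.Finite.fg_top
        (fun w _ => ?_) ?_
      · obtain ⟨w', rfl⟩ := htop.ge (Submodule.mem_top (x := w))
        rw [algebraMap_smul]
        exact Submodule.smul_mem_smul (Ideal.mem_span_singleton_self π) Submodule.mem_top
      · rw [IsLocalRing.jacobson_eq_maximalIdeal _ bot_ne_top,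
          (IsDiscreteValuationRing.irreducible_iff_uniformizer π).1 hπ]
    have : Submodule.span K (V : Set X) = ⊥ := Submodule.span_eq_bot.2 fun w hw =>
      congrArg Subtype.val ((Submodule.mem_bot S).1 (hbot.le (Submodule.mem_top (x := ⟨w, hw⟩))))
    exact bot_ne_top (this.symm.trans hKV)
  · obtain ⟨v, rfl⟩ := Submodule.Quotient.mk_surjective _ v
    obtain ⟨w, rfl⟩ := Submodule.Quotient.mk_surjective _ w
    obtain ⟨ξ, rfl⟩ := htransitive v (fun h => hv ((Submodule.Quotient.mk_eq_zero _).2 h)) w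
    exact ⟨TwistedGroupRing.red _ G π ξ, TwistedGroupRing.red_smul_mk π V ξ v⟩
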